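/- Work in the Euclidean plane $\mathbb{R}^2$. A directed line is a line with an orientation; two directed lines are equal if they have the same points and the same orientation. A directed line $t$ is a supporting line of $X\subseteq\mathbb{R}^2$ if $t\cap X\neq\emptyset$ and $X$ lies in the left closed half-plane determined by $t$. For compact convex sets $D,L\subseteq\mathbb{R}^2$, say that $D$ new-crosses $L$ if there are two distinct directed lines $t$ and $t'$, each of them a supporting line of both $D$ and $L$, such that, for each $s\in\{t,t'\}$, the first point of $(D\cup L)\cap s$ with respect to the orientation of $s$ is in $D\setminus L$ and the last point is in $L\setminus D$. Say that $D$ and $L$ weakly new-cross if $D$ new-crosses $L$ or $L$ new-crosses $D$. A set $X\subseteq\mathbb{R}^2$ is called connected if any two points of $X$ are joined by a continuous curve inside $X$ (so the empty set is connected), and $D$ and $L$ are crossing in the sense of Fejes-Tóth if neither $D\setminus L$ nor $L\setminus D$ is connected. Lemma 5 (Main Lemma). Let $D$ and $L$ be nonempty compact convex subsets of the plane $\mathbb{R}^2$. Then: (i) if $D$ new-crosses $L$, then $D$ and $L$ are crossing in the sense of Fejes-Tóth; (ii) if $D$ and $L$ weakly new-cross, then $D$ and $L$ are crossing in the sense of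 Fejes-Tóth. -/

import Mathlib

/-- The Euclidean plane. -/
abbrev Plane : Type := EuclideanSpace ℝ (Fin 2)

/-- A directed line of the plane, given by its direction, a point of the unit circle, and by the
value `offset` that the linear form `x ↦ det (dir, x)` takes on it. Each pair of a unit vector and
a real number is exactly one directed line, so two terms of this type are equal if and only if they
are the same line with the same orientation. -/
@[ext]
structure DirectedLine where
  dir : Plane
  norm_dir : ‖dir‖ = 1
  offset : ℝ

namespace DirectedLine

/-- The signed distance of `x` from the directed line `t`, positive strictly on the left of `t`. -/
def signedDist (t : DirectedLine) (x : Plane) : ℝ :=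
  t.dir 0 * x 1 - t.dir 1 * x 0 - t.offset

/-- The set of points of a directed line. -/
def points (t : DirectedLine) : Set Plane := {x | t.signedDist x = 0}

/-- The left closed half-plane determined by a directed line. -/
def leftHalfPlane (t : DirectedLine) : Set Plane := {x | 0 ≤ t.signedDist x}

/-- `A <_t B`: the vector from `A` to `B` has the same direction as `t`. It is meant for points
`A`, `B` of `t`. -/
def Before (t : DirectedLine) (A B : Plane) : Prop := ∃ r : ℝ, 0 < r ∧ B - A = r • t.dir

/-- `U` is the first point of `X ∩ t` with respect to the orientation of `t`. -/
def IsFirstPoint (t : DirectedLine) (X : Set Plane) (U : Plane) : Prop :=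
  U ∈ X ∩ t.points ∧ ∀ P ∈ X ∩ t.points, P ≠ U → t.Before U P

/-- `U` is the last point of `X ∩ t` with respect to the orientation of `t`. -/
def IsLastPoint (t : DirectedLine) (X : Set Plane) (U : Plane) : Prop :=
  U ∈ X ∩ t.points ∧ ∀ P ∈ X ∩ t.points, P ≠ U → t.Before P U

/-- `t` is a (directed) supporting line of `X`. -/
def IsSupporting (t : DirectedLine) (X : Set Plane) : Prop :=
  (t.points ∩ X).Nonempty ∧ X ⊆ t.leftHalfPlane

/-- The first point of `(D ∪ L) ∩ t` is in `D \ L` and the last one is in `L \ D`. -/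
def RunsFromTo (t : DirectedLine) (D L : Set Plane) : Prop :=
  (∃ U, t.IsFirstPoint (D ∪ L) U ∧ U ∈ D \ L) ∧ (∃ U, t.IsLastPoint (D ∪ L) U ∧ U ∈ L \ D)

end DirectedLine

/-- `D` new-crosses `L`. -/
def NewCrosses (D L : Set Plane) : Prop :=
  ∃ t t' : DirectedLine, t ≠ t' ∧
    (t.IsSupporting D ∧ t.IsSupporting L) ∧ (t'.IsSupporting D ∧ t'.IsSupporting L) ∧
    t.RunsFromTo D L ∧ t'.RunsFromTo D L

/-- `D` and `L` weakly new-cross. -/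
def WeaklyNewCross (D L : Set Plane) : Prop := NewCrosses D L ∨ NewCrosses L D

/-- Any two points of `X` are joined by a continuous curve inside `X`. In contrast to
`IsPathConnected`, the empty set has this property. -/
def PathConnectedOrEmpty (X : Set Plane) : Prop := ∀ A ∈ X, ∀ B ∈ X, JoinedIn X A B

/-- `X` and `Y` are crossing in the sense of Fejes-Tóth. -/
def FejesTothCrossing (X Y : Set Plane) : Prop :=
  ¬ PathConnectedOrEmpty (X \ Y) ∧ ¬ PathConnectedOrEmpty (Y \ X)

/-!
Let `A`, `A'` be the first points and `B`, `B'` the last points of `D ∪ L` on the two common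
supporting lines `t`, `t'`. Then `A`, `A'` cannot be joined inside `D \ L`, and `B`, `B'` cannot be
joined inside `L \ D`.

For the first claim, convexity puts the segment `[B, B']` inside `L`. The linear form vanishing on
the line `BB'` takes opposite signs at `A` and `A'`, so a curve in `D` from `A` to `A'` meets that
line, by the intermediate value theorem. As `D` lies to the left of both `t` and `t'`, the
meeting point lies on the segment `[B, B']`, hence in `L`. All this needs is that `B'` is not on `t`
and `B` is not on `t'` (`DirectedLine.signedDist_pos`): otherwise the two half-plane conditions
force `t` and `t'` to be parallel, and then the order of the points on the lines is violated.

The second claim is the same with all orientations reversed. To treat both at once, the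
extreme points carry a sign `ε`, and the separation statement is
`DirectedLine.not_joinedIn_diff`.
-/

namespace DirectedLine

/-- `U` is the extreme point of `X ∩ t` from which all others are reached in the direction
`ε • t.dir`: the first point for `ε = 1`, the last point for `ε = -1`. -/
def IsExtremePoint (t : DirectedLine) (ε : ℝ) (X : Set Plane) (U : Plane) : Prop :=
  U ∈ X ∩ t.points ∧ ∀ P ∈ X ∩ t.points, P ≠ U → ∃ r : ℝ, 0 < r ∧ P - U = (r * ε) • t.dir

theorem IsFirstPoint.isExtremePoint {t : DirectedLine} {X : Set Plane} {U : Plane}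
    (h : t.IsFirstPoint X U) : t.IsExtremePoint 1 X U := by
  refine ⟨h.1, fun P hP hne => ?_⟩
  obtain ⟨r, hr, e⟩ := h.2 P hP hne
  exact ⟨r, hr, by rw [e, mul_one]⟩

theorem IsLastPoint.isExtremePoint {t : DirectedLine} {X : Set Plane} {U : Plane}
    (h : t.IsLastPoint X U) : t.IsExtremePoint (-1) X U := by
  refine ⟨h.1, fun P hP hne => ?_⟩
  obtain ⟨r, hr, e⟩ := h.2 P hP hne
  exact ⟨r, hr, by rw [← neg_sub, e, mul_neg_one, neg_smul]⟩

theorem dir_sq_add_sq (t : DirectedLine) : t.dir 0 ^ 2 + t.dir 1 ^ 2 = 1 := by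
  have h := EuclideanSpace.norm_sq_eq t.dir
  rw [t.norm_dir] at h
  simpa [Fin.sum_univ_two] using h.symm

theorem coord_of_sub_eq_smul {P U v : Plane} {c : ℝ} (h : P - U = c • v) (i : Fin 2) :
    P i = U i + c * v i := by
  have := congrArg (fun w : Plane => w i) h
  simp only [PiLp.sub_apply, PiLp.smul_apply, smul_eq_mul] at this
  linarith

/-- Two distinct directed lines with a common point and parallel directions are opposite. -/
theorem dir_eq_neg_of_det_eq_zero {t t' : DirectedLine} (hne : t ≠ t') {P : Plane}
    (hP : t.signedDist P = 0) (hP' : t'.signedDist P = 0)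
    (hdet : t'.dir 0 * t.dir 1 - t'.dir 1 * t.dir 0 = 0) : t'.dir = -t.dir := by
  have h1 := t.dir_sq_add_sq
  have h2 := t'.dir_sq_add_sq
  -- The inner product `c` of the two directions is `1` or `-1`, and `t'.dir = c • t.dir`.
  set c := t.dir 0 * t'.dir 0 + t.dir 1 * t'.dir 1 with hc
  have e0 : t'.dir 0 = c * t.dir 0 := by
    rw [hc]; linear_combination (-t'.dir 0) * h1 + t.dir 1 * hdet
  have e1 : t'.dir 1 = c * t.dir 1 := by
    rw [hc]; linear_combination (-t'.dir 1) * h1 - t.dir 0 * hdet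
  have hsq : c ^ 2 = 1 := by
    rw [e0, e1] at h2
    linear_combination h2 - c ^ 2 * h1
  rcases eq_or_eq_neg_of_sq_eq_sq c 1 (by rw [hsq, one_pow]) with h | h
  · refine absurd ?_ hne
    rw [h, one_mul] at e0 e1
    ext i
    · fin_cases i
      · exact e0.symm
      · exact e1.symm
    · simp only [signedDist, e0, e1] at hP hP'
      linarith
  · rw [h] at e0 e1
    ext i
    fin_cases i
    · simpa using e0
    · simpa using e1

/-- If two distinct directed lines have a set `S` to their left, then the `ε`-extreme point of `S`
on `t'` is not on `t`, provided it is not the `-ε`-extreme point of `S` on `t`, nor the only point of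
`S` on `t'`. -/
theorem signedDist_pos {t t' : DirectedLine} (hne : t ≠ t') {ε : ℝ} (hε : ε ^ 2 = 1)
    {S : Set Plane} (hS : S ⊆ t.leftHalfPlane) (hS' : S ⊆ t'.leftHalfPlane) {P' Q Q' : Plane}
    (hP' : t'.IsExtremePoint ε S P') (hQ : t.IsExtremePoint (-ε) S Q)
    (hQ' : Q' ∈ S ∩ t'.points) (hPQ : P' ≠ Q) (hPQ' : Q' ≠ P') : 0 < t.signedDist P' := by
  refine lt_of_le_of_ne (hS hP'.1.1) fun h0 => ?_
  have hf := h0.symm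
  have hg : t'.signedDist P' = 0 := hP'.1.2
  obtain ⟨s, hs, es⟩ := hQ.2 P' ⟨hP'.1.1, hf⟩ hPQ
  obtain ⟨r, hr, er⟩ := hP'.2 Q' hQ' hPQ'
  have es0 := coord_of_sub_eq_smul es 0
  have es1 := coord_of_sub_eq_smul es 1
  have er0 := coord_of_sub_eq_smul er 0
  have er1 := coord_of_sub_eq_smul er 1
  -- `Q` and `Q'` being on the left of the lines bounds `ε * det (t'.dir, t.dir)` on both sides.
  have hgQ : t'.signedDist Q
      = s * (ε * (t'.dir 0 * t.dir 1 - t'.dir 1 * t.dir 0)) := by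
    simp only [signedDist, es0, es1] at hg ⊢
    linear_combination hg
  have hfQ' : t.signedDist Q'
      = -(r * (ε * (t'.dir 0 * t.dir 1 - t'.dir 1 * t.dir 0))) := by
    simp only [signedDist, er0, er1] at hf ⊢
    linear_combination hf
  have h1 : 0 ≤ t'.signedDist Q := hS' hQ.1.1
  have h2 : 0 ≤ t.signedDist Q' := hS hQ'.1
  have hεdet : ε * (t'.dir 0 * t.dir 1 - t'.dir 1 * t.dir 0) = 0 := by
    rw [hgQ] at h1
    rw [hfQ'] at h2
    exact le_antisymm (nonpos_of_mul_nonpos_right (by linarith) hr)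
      (nonneg_of_mul_nonneg_right h1 hs)
  have hε0 : ε ≠ 0 := fun h => by simp [h] at hε
  have hdir := dir_eq_neg_of_det_eq_zero hne hf hg ((mul_eq_zero.mp hεdet).resolve_left hε0)
  -- Now `t'` is `t` reversed, and `Q` lies on the wrong side of `P'` on it.
  have hQt' : Q ∈ S ∩ t'.points := ⟨hQ.1.1, by
    change t'.signedDist Q = 0
    rw [hgQ, hεdet, mul_zero]⟩
  obtain ⟨q, hq, eq⟩ := hP'.2 Q hQt' hPQ.symm
  have hzero : ((q + s) * ε) • t.dir = 0 := by
    have : (s * -ε) • t.dir + (q * ε) • t'.dir = 0 := by rw [← es, ← eq]; abel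
    rw [hdir] at this
    rw [← neg_eq_zero, ← this]
    module
  rcases smul_eq_zero.mp hzero with h | h
  · rcases mul_eq_zero.mp h with h | h
    · linarith
    · exact hε0 h
  · have := t.norm_dir
    rw [h, norm_zero] at this
    exact zero_ne_one this

/-- Let `X ∪ Y` lie to the left of two distinct directed lines, with the `ε`-extreme points on them
in `Y` and the `-ε`-extreme points outside `Y`. Then no curve in `X \ Y` joins the latter two:
the segment between the former two separates them. -/
theorem not_joinedIn_diff {t t' : DirectedLine} (hne : t ≠ t') {ε : ℝ} (hε : ε ^ 2 = 1)
    {X Y : Set Plane} (hS : X ∪ Y ⊆ t.leftHalfPlane) (hS' : X ∪ Y ⊆ t'.leftHalfPlane)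
    (hY : Convex ℝ Y) {P P' Q Q' : Plane}
    (hP : t.IsExtremePoint ε (X ∪ Y) P) (hP' : t'.IsExtremePoint ε (X ∪ Y) P')
    (hQ : t.IsExtremePoint (-ε) (X ∪ Y) Q) (hQ' : t'.IsExtremePoint (-ε) (X ∪ Y) Q')
    (hPY : P ∈ Y) (hPY' : P' ∈ Y) (hQY : Q ∉ Y) (hQY' : Q' ∉ Y) :
    ¬ JoinedIn (X \ Y) Q Q' := by
  have ne : ∀ {U V : Plane}, U ∈ Y → V ∉ Y → U ≠ V := fun hU hV h => hV (h ▸ hU)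
  have hfP' : 0 < t.signedDist P' :=
    signedDist_pos hne hε hS hS' hP' hQ hQ'.1 (ne hPY' hQY) (ne hPY' hQY').symm
  have hgP : 0 < t'.signedDist P :=
    signedDist_pos hne.symm hε hS' hS hP hQ' hQ.1 (ne hPY hQY') (ne hPY hQY).symm
  have hfP : t.signedDist P = 0 := hP.1.2
  have hgP' : t'.signedDist P' = 0 := hP'.1.2
  obtain ⟨r, hr, er⟩ := hP.2 Q hQ.1 (ne hPY hQY).symm
  obtain ⟨r', hr', er'⟩ := hP'.2 Q' hQ'.1 (ne hPY' hQY').symm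
  have er0 := coord_of_sub_eq_smul er 0
  have er1 := coord_of_sub_eq_smul er 1
  have er0' := coord_of_sub_eq_smul er' 0
  have er1' := coord_of_sub_eq_smul er' 1
  rintro ⟨γ, hγ⟩
  -- The affine form vanishing on the line `PP'`, along the curve; the factor `ε` fixes its sign.
  let h : Plane → ℝ := fun x =>
    ε * ((P' 0 - P 0) * (x 1 - P 1) - (P' 1 - P 1) * (x 0 - P 0))
  have hcont : Continuous h := by
    unfold h
    fun_prop
  have hhQ : h Q = -(r * t.signedDist P') := by
    simp only [h, signedDist, er0, er1] at hfP ⊢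
    linear_combination (-r * (t.dir 0 * P' 1 - t.dir 1 * P' 0 - t.dir 0 * P 1 + t.dir 1 * P 0)) * hε
      + r * hfP
  have hhQ' : h Q' = r' * t'.signedDist P := by
    simp only [h, signedDist, er0', er1'] at hgP' ⊢
    linear_combination
      (-r' * (t'.dir 0 * P' 1 - t'.dir 1 * P' 0 - t'.dir 0 * P 1 + t'.dir 1 * P 0)) * hε
      - r' * hgP'
  have hIVT := intermediate_value_univ 0 1 (hcont.comp γ.continuous)
  have hmem : (0 : ℝ) ∈ Set.Icc ((h ∘ γ) 0) ((h ∘ γ) 1) := by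
    simp only [Function.comp_apply, γ.source, γ.target, hhQ, hhQ']
    exact ⟨by nlinarith [mul_pos hr hfP'], (mul_pos hr' hgP).le⟩
  obtain ⟨s, hs⟩ := hIVT hmem
  obtain ⟨hx, hxY⟩ := hγ s
  set x := γ s
  have hε0 : ε ≠ 0 := fun h => by simp [h] at hε
  have hx0 : (P' 0 - P 0) * (x 1 - P 1) - (P' 1 - P 1) * (x 0 - P 0) = 0 :=
    (mul_eq_zero.mp hs).resolve_left hε0
  have hfx : 0 ≤ t.signedDist x := hS (Or.inl hx)
  have hgx : 0 ≤ t'.signedDist x := hS' (Or.inl hx)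
  -- On the line `PP'` the parameter of `x` can be read off from either signed distance.
  set l := t.signedDist x / t.signedDist P'
  have hl0 : 0 ≤ l := div_nonneg hfx hfP'.le
  have hlf : l * t.signedDist P' = t.signedDist x := div_mul_cancel₀ _ hfP'.ne'
  have hx_coord : ∀ i, x i = (1 - l) * P i + l * P' i := by
    intro i
    apply mul_left_cancel₀ hfP'.ne'
    simp only [signedDist] at hfP hlf ⊢
    fin_cases i
    · simp only [Fin.zero_eta]
      linear_combination (P 0 - P' 0) * hlf - t.dir 0 * hx0 + (x 0 - P' 0) * hfP
    · simp only [Fin.mk_one]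
      linear_combination (P 1 - P' 1) * hlf - t.dir 1 * hx0 + (x 1 - P' 1) * hfP
  have hl1 : 0 ≤ 1 - l := by
    have : t'.signedDist x = (1 - l) * t'.signedDist P := by
      simp only [signedDist, hx_coord] at hgP' ⊢
      linear_combination l * hgP'
    rw [this] at hgx
    exact nonneg_of_mul_nonneg_left hgx hgP
  refine hxY ?_
  have hxeq : x = (1 - l) • P + l • P' := by
    ext i
    simpa using hx_coord i
  rw [hxeq]
  exact hY hPY hPY' hl1 hl0 (by ring)

end DirectedLine

open DirectedLine in
theorem NewCrosses.fejesTothCrossing {D L : Set Plane} (hD : Convex ℝ D) (hL : Convex ℝ L)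
    (h : NewCrosses D L) : FejesTothCrossing D L := by
  obtain ⟨t, t', hne, ⟨hDt, hLt⟩, ⟨hDt', hLt'⟩, ⟨⟨A, hA, hAD⟩, ⟨B, hB, hBL⟩⟩,
    ⟨⟨A', hA', hAD'⟩, ⟨B', hB', hBL'⟩⟩⟩ := h
  have eA := hA.isExtremePoint
  have eA' := hA'.isExtremePoint
  have eB := hB.isExtremePoint
  have eB' := hB'.isExtremePoint
  have hS := Set.union_subset hDt.2 hLt.2
  have hS' := Set.union_subset hDt'.2 hLt'.2
  constructor
  · intro hc
    rw [← neg_neg (1 : ℝ)] at eA eA'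
    exact not_joinedIn_diff hne (by norm_num) hS hS' hL eB eB' eA eA' hBL.1 hBL'.1 hAD.2 hAD'.2
      (hc A hAD A' hAD')
  · intro hc
    rw [Set.union_comm] at eA eA' eB eB' hS hS'
    exact not_joinedIn_diff hne (by norm_num) hS hS' hD eA eA' eB eB' hAD.1 hAD'.1 hBL.2 hBL'.2
      (hc B hBL B' hBL')

theorem lemma5 (D L : Set Plane)
    (hDne : D.Nonempty) (hDcompact : IsCompact D) (hDconvex : Convex ℝ D)
    (hLne : L.Nonempty) (hLcompact : IsCompact L) (hLconvex : Convex ℝ L) :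
    (NewCrosses D L → FejesTothCrossing D L) ∧
    (WeaklyNewCross D L → FejesTothCrossing D L) := by
  refine ⟨fun h => h.fejesTothCrossing hDconvex hLconvex, ?_⟩
  rintro (h | h)
  · exact h.fejesTothCrossing hDconvex hLconvex
  · exact (h.fejesTothCrossing hLconvex hDconvex).symm
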